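/- Let $\mathbf{F}$ be a finite field with $q$ elements, let $k$ be a field in which $q \neq 0$, and let $0 \le r \le n-1$ be integers. Let $\mathfrak{M}_n$ be the monoid of $n \times n$ matrices over $\mathbf{F}$ under multiplication, $k[\mathfrak{M}_n]$ its monoid algebra with basis elements $[m]$, and $\mathfrak{a}_{n,r} \subset k[\mathfrak{M}_n]$ the two-sided ideal spanned by the $[m]$ with $\operatorname{rank} m \le r$. Call a matrix $m$ semi-idempotent if $\mathbf{F}^n = X \oplus Y$ for some $m$-stable subspaces $X, Y$ such that $m$ is the identity on $X$ and nilpotent on $Y$. Let $\operatorname{srk} m$ (the stable rank) be the rank of $m^i$ for all sufficiently large $i$. Put $\mu(i) = (-1)^i q^{\binom{i}{2}}$, and for $0 \le b \le a$ let $$\begin{bmatrix} a \\ b \end{bmatrix}_q = \frac{[a]_q!}{[b]_q!\,[a-b]_q!}, \qquad [a]_q! = \prod_{j=1}^{a} (1+q+\cdots+q^{j-1}),$$ which is an integer, regarded as an element of $k$. Define $$\eta_r = q^{-(n-1)r}\, \mu(r) \sum_{m} \mu(\operatorname{srk} m) \begin{bmatrix} n-1-\operatorname{rank} m \\ r-\operatorname{rank}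 m \end{bmatrix}_q [m] \in k[\mathfrak{M}_n],$$ where the sum is over all semi-idempotent $m \in \mathfrak{M}_n$ with $\operatorname{rank} m \le r$. Then $\eta_r$ is the two-sided unit of $\mathfrak{a}_{n,r}$: that is, $\eta_r \in \mathfrak{a}_{n,r}$, and $\eta_r x = x = x \eta_r$ for every $x \in \mathfrak{a}_{n,r}$. -/

import Mathlib

namespace MatrixMonoid

open Filter

/-- The `q`-integer `[n]_q = 1 + q + ⋯ + q^(n-1)`. -/
def qInt (q n : ℕ) : ℕ := ∑ i ∈ Finset.range n, q ^ i

/-- The `q`-factorial `[n]_q! = [n]_q [n-1]_q ⋯ [1]_q`. -/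
def qFactorial (q : ℕ) : ℕ → ℕ
  | 0 => 1
  | n + 1 => qInt q (n + 1) * qFactorial q n

/-- The `q`-binomial coefficient `[n]_q! / ([m]_q! [n-m]_q!)` for `m ≤ n`, and `0` for `m > n`.
The division is exact, see `qBinom_mul`. -/
def qBinom (q n m : ℕ) : ℕ :=
  if m ≤ n then qFactorial q n / (qFactorial q m * qFactorial q (n - m)) else 0

theorem qFactorial_mul_dvd (q : ℕ) (a b : ℕ) :
    qFactorial q a * qFactorial q b ∣ qFactorial q (a + b) := by
  induction a generalizing b with
  | zero => simp [qFactorial]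
  | succ a iha =>
    induction b with
    | zero => simp [qFactorial]
    | succ b ihb =>
      have h1 : qInt q (a + 1 + (b + 1)) = qInt q (a + 1) + q ^ (a + 1) * qInt q (b + 1) := by
        simp only [qInt, Finset.sum_range_add _ (a + 1) (b + 1), Finset.mul_sum, pow_add]
      have h2 : qFactorial q (a + 1 + (b + 1))
          = qInt q (a + 1) * qFactorial q (a + (b + 1))
            + q ^ (a + 1) * (qInt q (b + 1) * qFactorial q (a + 1 + b)) := by
        have : qFactorial q (a + 1 + (b + 1))
            = qInt q (a + 1 + (b + 1)) * qFactorial q (a + 1 + b) := rfl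
        rw [this, h1, show a + (b + 1) = a + 1 + b by ring]
        ring
      rw [h2]
      refine dvd_add ?_ (Dvd.dvd.mul_left ?_ _)
      · have := mul_dvd_mul_left (qInt q (a + 1)) (iha (b + 1))
        simpa [qFactorial, mul_assoc] using this
      · have := mul_dvd_mul_left (qInt q (b + 1)) ihb
        rw [show qFactorial q (b + 1) = qInt q (b + 1) * qFactorial q b from rfl]
        rwa [mul_left_comm]

theorem qBinom_mul (q : ℕ) {n m : ℕ} (h : m ≤ n) :
    qBinom q n m * (qFactorial q m * qFactorial q (n - m)) = qFactorial q n := by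
  rw [qBinom, if_pos h]
  refine Nat.div_mul_cancel ?_
  simpa [Nat.add_sub_cancel' h] using qFactorial_mul_dvd q m (n - m)

/-- `μ(i) = (-1)^i q^(i choose 2)`, as an element of the coefficient field `k`. -/
def mu (k : Type*) [Field k] (q i : ℕ) : k := (-1) ^ i * (q : k) ^ (i.choose 2)

/-- A linear operator `T` on `V` is semi-idempotent if `V = X ⊕ Y` with `X`, `Y` stable under `T`,
`T` the identity on `X` and nilpotent on `Y`. -/
def IsSemiIdempotent {F V : Type*} [Field F] [AddCommGroup V] [Module F V]
    (T : Module.End F V) : Prop :=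
  ∃ X Y : Submodule F V, IsCompl X Y ∧ (∀ x ∈ X, T x = x) ∧ (∀ y ∈ Y, T y ∈ Y) ∧
    ∃ N : ℕ, ∀ y ∈ Y, (T ^ N) y = 0

/-- The stable rank of a square matrix `m`: the rank of `m ^ i` for all large `i`
(see `eventually_rank_pow_eq`). These ranks decrease with `i`, so it is their infimum. -/
noncomputable def stableRank {F : Type*} [Field F] {n : ℕ} (m : Matrix (Fin n) (Fin n) F) : ℕ :=
  ⨅ i : ℕ, (m ^ i).rank

theorem eventually_rank_pow_eq {F : Type*} [Field F] {n : ℕ} (m : Matrix (Fin n) (Fin n) F) :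
    ∀ᶠ i in atTop, (m ^ i).rank = stableRank m := by
  obtain ⟨N, hN⟩ : ∃ N, (m ^ N).rank = stableRank m :=
    Nat.sInf_mem (Set.range_nonempty fun i : ℕ => (m ^ i).rank)
  filter_upwards [eventually_ge_atTop N] with i hi
  refine le_antisymm ?_ (Nat.sInf_le ⟨i, rfl⟩)
  rw [← hN, ← Nat.add_sub_cancel' hi, pow_add]
  exact Matrix.rank_mul_le_left _ _

/-- The subspace of the monoid algebra `k[M_n]` spanned by the `[m]` with `rank m ≤ r`. -/
noncomputable def rankSpan (k F : Type*) [Field k] [Field F] (n r : ℕ) :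
    Submodule k (MonoidAlgebra k (Matrix (Fin n) (Fin n) F)) :=
  Submodule.span k {x | ∃ m : Matrix (Fin n) (Fin n) F, m.rank ≤ r ∧ x = MonoidAlgebra.single m 1}

theorem mul_mem_rankSpan (k F : Type*) [Field k] [Field F] (n r : ℕ)
    (a b : MonoidAlgebra k (Matrix (Fin n) (Fin n) F)) (hb : b ∈ rankSpan k F n r) :
    a * b ∈ rankSpan k F n r ∧ b * a ∈ rankSpan k F n r := by
  induction a using MonoidAlgebra.induction_linear with
  | zero => simp
  | add f g hf hg =>
    rw [add_mul, mul_add]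
    exact ⟨add_mem hf.1 hg.1, add_mem hf.2 hg.2⟩
  | single p c =>
    induction hb using Submodule.span_induction with
    | zero => simp
    | add x y _ _ hx hy =>
      rw [add_mul, mul_add]
      exact ⟨add_mem hx.1 hy.1, add_mem hx.2 hy.2⟩
    | smul t x _ hx =>
      rw [smul_mul_assoc, mul_smul_comm]
      exact ⟨Submodule.smul_mem _ _ hx.1, Submodule.smul_mem _ _ hx.2⟩
    | mem x hx =>
      obtain ⟨m, hm, rfl⟩ := hx
      have key : ∀ s : Matrix (Fin n) (Fin n) F, s.rank ≤ r →
          MonoidAlgebra.single s c ∈ rankSpan k F n r := fun s hs => by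
        have := Submodule.smul_mem (rankSpan k F n r) c (Submodule.subset_span ⟨s, hs, rfl⟩)
        simpa using this
      rw [MonoidAlgebra.single_mul_single, MonoidAlgebra.single_mul_single, mul_one, one_mul]
      exact ⟨key _ ((Matrix.rank_mul_le_right _ _).trans hm),
        key _ ((Matrix.rank_mul_le_left _ _).trans hm)⟩

/-- The two-sided ideal `a_{n,r}` of `k[M_n]`, whose underlying set is the span of the `[m]` with
`rank m ≤ r`. -/
noncomputable def rankIdeal (k F : Type*) [Field k] [Field F] (n r : ℕ) :
    TwoSidedIdeal (MonoidAlgebra k (Matrix (Fin n) (Fin n) F)) :=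
  TwoSidedIdeal.mk' (rankSpan k F n r : Set _) (zero_mem _) add_mem neg_mem
    (fun {a b} hb => (mul_mem_rankSpan k F n r a b hb).1)
    (fun {a b} ha => (mul_mem_rankSpan k F n r b a ha).2)

theorem mem_rankIdeal (k F : Type*) [Field k] [Field F] (n r : ℕ)
    (x : MonoidAlgebra k (Matrix (Fin n) (Fin n) F)) :
    x ∈ rankIdeal k F n r ↔ x ∈ rankSpan k F n r := by
  simp [rankIdeal, TwoSidedIdeal.mem_mk']

open Classical in
/-- The element `η_r` of `k[M_n]`, where `q = #F`; the sum runs over the semi-idempotent matrices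
of rank at most `r`. -/
noncomputable def eta (k F : Type*) [Field k] [Field F] [Fintype F] (n r : ℕ) :
    MonoidAlgebra k (Matrix (Fin n) (Fin n) F) :=
  (((Fintype.card F : k) ^ ((n - 1) * r))⁻¹ * mu k (Fintype.card F) r) •
    ∑ m : Matrix (Fin n) (Fin n) F with IsSemiIdempotent (Matrix.toLin' m) ∧ m.rank ≤ r,
      (mu k (Fintype.card F) (stableRank m) *
        (qBinom (Fintype.card F) (n - 1 - m.rank) (r - m.rank) : k)) •
          MonoidAlgebra.single m (1 : k)

end MatrixMonoid

/-! Give an operator weight `μ(srk T)` if it is semi-idempotent and `0` otherwise. The weight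
satisfies `weight (BA) = weight (AB)`, so an operator factoring through a smaller space can be
replaced by one on that space. The key fact, `sum_weight_add_smulRight`, is that the weights of all
extensions of a linear map from a hyperplane of `U` into `U` sum to zero.

Let `t_r` (`grassmannSum`) be the sum of `weight T [T]` over pairs `(U, T)` with `dim U = r` and `im
T ⊆ U`. In `t_r [x]` the element `[Tx]` depends only on `T` restricted to `W = im x`, so the key
fact kills the contribution of every `U` not inside `W`. Hence `t_r [x] = 0` when `rank x < r`. When
`rank x = r` only `U = W` survives: the projections onto `W` give `q^(r(n-r)) μ(r) [x]`, and
everything else has weight zero or lowers the rank. Transposition gives the same on the right.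

So if `e` is a unit of the ideal of rank `< r`, adding the right multiple of `t_r` gives a unit of
the ideal of rank `≤ r` (`isUnitOn_add_grassmannSum`). By the `q`-Pascal identity the elements `η_r`
obey exactly this recursion (`eta_succ`). -/

namespace MatrixMonoid

open Module

/-! ### The weight of an operator and its cyclic invariance. -/

section Weight

variable (k : Type*) [Field k] {F : Type*} [Field F]

/-- The rank of all sufficiently high powers of `T`. -/
noncomputable def endStableRank {U : Type*} [AddCommGroup U] [Module F U] (T : End F U) : ℕ :=
  ⨅ i : ℕ, finrank F (LinearMap.range (T ^ i))

open Classical in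
/-- `μ` of the stable rank on operators with `T ^ (N + 1) = T ^ N` for some `N`
(that is, on the semi-idempotent ones), and `0` on all others. -/
noncomputable def weight [Fintype F] {U : Type*} [AddCommGroup U] [Module F U] (T : End F U) : k :=
  if ∃ N : ℕ, T ^ (N + 1) = T ^ N then mu k (Fintype.card F) (endStableRank T) else 0

theorem mu_succ (q i : ℕ) : mu k q (i + 1) = -(q : k) ^ i * mu k q i := by
  simp only [mu, pow_succ, Nat.choose_succ_succ' i 1, Nat.choose_one_right, pow_add]
  ring

variable {U V : Type*} [AddCommGroup U] [Module F U] [AddCommGroup V] [Module F V]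

theorem comp_pow_succ (A : U →ₗ[F] V) (B : V →ₗ[F] U) (N : ℕ) :
    (B ∘ₗ A : End F U) ^ (N + 1) = B ∘ₗ ((A ∘ₗ B : End F V) ^ N) ∘ₗ A := by
  induction N with
  | zero => ext; simp
  | succ N ih =>
    rw [pow_succ, ih, pow_succ (A ∘ₗ B)]
    rfl

theorem endStableRank_comp_le [Module.Finite F U] [Module.Finite F V]
    (A : U →ₗ[F] V) (B : V →ₗ[F] U) :
    endStableRank (B ∘ₗ A) ≤ endStableRank (A ∘ₗ B) := by
  refine le_ciInf fun i => ?_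
  refine (Nat.sInf_le ⟨i + 1, rfl⟩ : endStableRank (B ∘ₗ A) ≤ _).trans ?_
  beta_reduce
  rw [comp_pow_succ, LinearMap.range_comp]
  refine (Submodule.finrank_map_le _ _).trans (Submodule.finrank_mono ?_)
  exact LinearMap.range_comp_le_range _ _

theorem pow_stable_comp (A : U →ₗ[F] V) (B : V →ₗ[F] U)
    (h : ∃ N : ℕ, (A ∘ₗ B : End F V) ^ (N + 1) = (A ∘ₗ B) ^ N) :
    ∃ N : ℕ, (B ∘ₗ A : End F U) ^ (N + 1) = (B ∘ₗ A) ^ N := by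
  obtain ⟨N, hN⟩ := h
  exact ⟨N + 1, by rw [comp_pow_succ A B (N + 1), comp_pow_succ A B N, hN]⟩

/-- Since `(BA)^(N+1) = B (AB)^N A`, both the stabilization of powers and the stable rank pass
between `BA` and `AB`. -/
theorem weight_comp_comm [Fintype F] [Module.Finite F U] [Module.Finite F V]
    (A : U →ₗ[F] V) (B : V →ₗ[F] U) :
    weight k (B ∘ₗ A : End F U) = weight k (A ∘ₗ B : End F V) := by
  unfold weight
  rw [le_antisymm (endStableRank_comp_le A B) (endStableRank_comp_le B A)]
  by_cases h : ∃ N : ℕ, (A ∘ₗ B : End F V) ^ (N + 1) = (A ∘ₗ B) ^ N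
  · rw [if_pos h, if_pos (pow_stable_comp A B h)]
  · rw [if_neg h, if_neg fun h' => h (pow_stable_comp B A h')]

theorem weight_one [Fintype F] : weight k (1 : End F U) = mu k (Fintype.card F) (finrank F U) := by
  rw [weight, if_pos ⟨0, by simp⟩, endStableRank]
  have h (i : ℕ) : finrank F (LinearMap.range ((1 : End F U) ^ i)) = finrank F U := by
    rw [one_pow, Module.End.one_eq_id, LinearMap.range_id, finrank_top]
  rw [iInf_congr h, ciInf_const]

/-- Cancelling the injective `T ^ N` in `T ^ (N + 1) = T ^ N` would force `T = 1`. -/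
theorem weight_eq_zero_of_injective [Fintype F] {T : End F U} (hT : Function.Injective T) (h1 : T ≠ 1) :
    weight k T = 0 := by
  rw [weight, if_neg]
  rintro ⟨N, hN⟩
  refine h1 (LinearMap.ext fun x => ?_)
  have hinj : Function.Injective (T ^ N) := by
    rw [Module.End.coe_pow]
    exact hT.iterate N
  refine hinj ?_
  rw [← Module.End.mul_apply, ← pow_succ, hN]
  rfl

end Weight

/-! ### Vanishing of the weight sum over extensions from a hyperplane. -/

section SumOverRankOne

variable (k : Type*) [Field k] {F : Type*} [Field F] [Fintype F]

theorem sum_comp_eq_zero_of_surjective {A B M : Type*} [AddCommGroup A] [AddCommGroup B]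
    [Fintype A] [Fintype B] [AddCommMonoid M] (p : A →+ B) (hp : Function.Surjective p)
    (f : B → M) (hf : ∑ b, f b = 0) : ∑ a, f (p a) = 0 := by
  classical
  rw [← Finset.sum_fiberwise (s := Finset.univ) (g := p)]
  have : ∀ b ∈ (Finset.univ : Finset B), ∑ a with p a = b, f (p a)
      = (Finset.card {a | p a = 0}) • f b := by
    intro b _
    rw [Finset.sum_congr rfl (g := fun _ => f b) (fun a ha => by simp at ha; rw [ha]),
      Finset.sum_const, AddMonoidHom.card_fiber_eq_of_mem_range p (hp b) (hp 0)]
  rw [Finset.sum_congr rfl this, ← Finset.smul_sum, hf, smul_zero]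

variable {U : Type*} [AddCommGroup U] [Module F U]

/-- The sum over the operators that differ from the identity by `l ⊗ u`. -/
theorem sum_weight_one_add_smulRight [Fintype U] (l : U →ₗ[F] F) (hl : l ≠ 0) :
    ∑ u : U, weight k (1 + l.smulRight u : End F U) = 0 := by
  classical
  have hd : finrank F (LinearMap.ker l) + 1 = finrank F U :=
    Module.Dual.finrank_ker_add_one_of_ne_zero hl
  obtain ⟨v, hv⟩ : ∃ v, l v = -1 := by
    obtain ⟨x, hx⟩ := DFunLike.ne_iff.1 hl
    exact ⟨(-(l x)⁻¹) • x, by simp at hx; simp [hx]⟩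
  -- If `l u = -1`, the operator is a projection onto `ker l`. With `d = dim U`, there are `q^(d-1)`
  -- such `u`, and `μ(d) = -q^(d-1) μ(d-1)` makes them cancel the identity, which is the term `u =
  -- 0`. All other terms are injective and not the identity.
  have hproj : ∀ u, l u = -1 →
      weight k (1 + l.smulRight u : End F U)
        = mu k (Fintype.card F) (finrank F (LinearMap.ker l)) := by
    intro u hu
    let p : U →ₗ[F] LinearMap.ker l :=
      (1 + l.smulRight u : End F U).codRestrict _ (fun x => by simp [hu])
    have h1 : (1 + l.smulRight u : End F U) = (LinearMap.ker l).subtype ∘ₗ p := by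
      rfl
    have h2 : p ∘ₗ (LinearMap.ker l).subtype = 1 := by
      refine LinearMap.ext fun x => Subtype.ext ?_
      have hx : l x = 0 := x.2
      change (x : U) + l x • u = x
      simp [hx]
    rw [h1, weight_comp_comm, h2, weight_one]
  have hother : ∀ u, u ≠ 0 → l u ≠ -1 → weight k (1 + l.smulRight u : End F U) = 0 := by
    intro u h0 hu
    refine weight_eq_zero_of_injective k ?_ ?_
    · rw [← LinearMap.ker_eq_bot, LinearMap.ker_eq_bot']
      intro x hx
      have hx' : x + l x • u = 0 := by simpa using hx
      have : l x * (1 + l u) = 0 := by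
        have := congrArg l hx'
        simp at this
        linear_combination this
      rcases mul_eq_zero.1 this with h | h
      · simpa [h] using hx'
      · exact absurd (by linear_combination h) hu
    · intro h
      have := LinearMap.congr_fun h v
      simp [hv] at this
      exact h0 this
  have hcard : (Finset.univ.filter fun u : U => l u = -1).card
      = Fintype.card F ^ finrank F (LinearMap.ker l) := by
    rw [AddMonoidHom.card_fiber_eq_of_mem_range (l : U →ₗ[F] F) (x := -1) (y := 0) ⟨v, hv⟩
      ⟨0, by simp⟩, ← Module.card_eq_pow_finrank (V := LinearMap.ker l), Fintype.card_subtype]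
    simp
  have hsplit : ∀ u : U, weight k (1 + l.smulRight u : End F U)
      = (if u = 0 then mu k (Fintype.card F) (finrank F U) else 0)
        + if l u = -1 then mu k (Fintype.card F) (finrank F (LinearMap.ker l)) else 0 := by
    intro u
    by_cases h0 : u = 0
    · subst h0
      simp [weight_one]
    · by_cases hu : l u = -1
      · simp [h0, hu, hproj]
      · simp [h0, hu, hother]
  rw [Finset.sum_congr rfl fun u _ => hsplit u, Finset.sum_add_distrib, Finset.sum_ite_eq',
    ← Finset.sum_filter, Finset.sum_const, hcard, ← hd, mu_succ]
  simp

end SumOverRankOne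

/-- For fixed values on a hyperplane `ker l`, the weights of all extensions of the partial
operator sum to zero. -/
theorem sum_weight_add_smulRight.{u, v, w} (k : Type w) [Field k] {F : Type v} [Field F] [Fintype F]
    {U : Type u} [AddCommGroup U] [Module F U] [Fintype U] (g : End F U)
    (l : U →ₗ[F] F) (hl : l ≠ 0) :
    ∑ u : U, weight k (g + l.smulRight u : End F U) = 0 := by
  classical
  induction hd : finrank F U using Nat.strong_induction_on generalizing U with
  | _ d ih =>
  subst hd
  -- Every extension kills `K = ker g ∩ ker l`. If `K ≠ 0`, cyclic invariance moves the sum to `U /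
  -- K`, where induction applies.
  by_cases hK : LinearMap.ker g ⊓ LinearMap.ker l = ⊥
  swap
  · set K := LinearMap.ker g ⊓ LinearMap.ker l with hKdef
    have := Fintype.ofFinite (U ⧸ K)
    let g' : U ⧸ K →ₗ[F] U := K.liftQ g inf_le_left
    let l' : U ⧸ K →ₗ[F] F := K.liftQ l inf_le_right
    have hl' : l' ≠ 0 := by
      intro h
      refine hl (LinearMap.ext fun x => ?_)
      exact LinearMap.congr_fun h (K.mkQ x)
    have hlt : finrank F (U ⧸ K) < finrank F U := by
      have h1 := K.finrank_quotient_add_finrank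
      have h2 : 0 < finrank F K := by
        rw [Nat.pos_iff_ne_zero, Ne, Submodule.finrank_eq_zero]
        exact hK
      omega
    have key := ih _ hlt (K.mkQ ∘ₗ g') l' hl' rfl
    rw [← sum_comp_eq_zero_of_surjective (K.mkQ : U →+ U ⧸ K) K.mkQ_surjective _ key]
    refine Finset.sum_congr rfl fun u _ => ?_
    have h1 : (g + l.smulRight u : End F U) = (g' + l'.smulRight u) ∘ₗ K.mkQ := by
      ext x; simp [g', l']
    rw [h1, weight_comp_comm]
    congr 1
  have hinj : ∀ x, g x = 0 → l x = 0 → x = 0 := fun x h1 h2 =>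
    (Submodule.eq_bot_iff _).1 hK x ⟨h1, h2⟩
  -- If some extension is the identity, translating `u` reduces to the case `g = 1`. Otherwise only
  -- singular extensions can have nonzero weight.
  by_cases hone : ∃ u, g + l.smulRight u = 1
  · obtain ⟨w, hw⟩ := hone
    rw [← sum_weight_one_add_smulRight k l hl, ← Equiv.sum_comp (Equiv.addLeft w)]
    refine Finset.sum_congr rfl fun u _ => ?_
    rw [← hw]
    congr 1
    ext x
    simp [add_assoc]
  obtain ⟨v₀, hv₀⟩ : ∃ v, l v = 1 := by
    obtain ⟨x, hx⟩ := DFunLike.ne_iff.1 hl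
    exact ⟨(l x)⁻¹ • x, by simp at hx; simp [hx]⟩
  set H := LinearMap.ker l with hH
  have := Fintype.ofFinite H
  -- The singular extensions are those with value `-g v` for some `v` with `l v = 1`.
  have hsum : ∑ u : U, weight k (g + l.smulRight u : End F U)
      = ∑ h : H, weight k (g + l.smulRight (-g (v₀ + h)) : End F U) := by
    have hi : Function.Injective fun h : H => -g (v₀ + h) := by
      intro a b hab
      have ha : l a = 0 := a.2
      have hb : l b = 0 := b.2
      have h1 : g (a - b) = 0 := by
        simp only [map_add, neg_inj, add_right_inj] at hab
        rw [map_sub, hab, sub_self]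
      exact Subtype.ext (sub_eq_zero.1 (hinj _ h1 (by rw [map_sub, ha, hb, sub_self])))
    rw [← Finset.sum_image (s := Finset.univ) (g := fun h : H => -g (v₀ + h))
      (f := fun u => weight k (g + l.smulRight u : End F U)) (fun a _ b _ h => hi h)]
    symm
    refine Finset.sum_subset (Finset.subset_univ _) fun u _ hu => ?_
    refine weight_eq_zero_of_injective k ?_ fun h => hone ⟨u, h⟩
    rw [← LinearMap.ker_eq_bot, LinearMap.ker_eq_bot']
    intro x hx
    have hx' : g x + l x • u = 0 := by simpa using hx
    by_cases hlx : l x = 0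
    · exact hinj x (by simpa [hlx] using hx') hlx
    · have hmem : (l x)⁻¹ • x - v₀ ∈ H := by simp [hH, hlx, hv₀]
      refine absurd (Finset.mem_image.2 ⟨⟨_, hmem⟩, Finset.mem_univ _, ?_⟩) hu
      have : g x = -(l x • u) := eq_neg_of_add_eq_zero_left hx'
      simp [this, smul_smul, hlx]
  -- The projection onto `H` along `v₀`; `p - l ⊗ h` is then the projection along `v₀ + h`. A
  -- singular extension is `g|_H` after such a projection, so cyclic invariance turns it into an
  -- operator on `H`.
  let p : U →ₗ[F] H := (1 - l.smulRight v₀ : End F U).codRestrict _ (fun x => by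
    simp [hH, hv₀])
  have hp (x : U) : (p x : U) = x - l x • v₀ := rfl
  clear_value p
  let m : H →ₗ[F] F := l ∘ₗ g ∘ₗ H.subtype
  have hterm : ∀ h : H, weight k (g + l.smulRight (-g (v₀ + h)) : End F U)
      = weight k (p ∘ₗ g ∘ₗ H.subtype + m.smulRight (-h) : End F H) := by
    intro h
    have hfac : (g + l.smulRight (-g (v₀ + h)) : End F U)
        = (g ∘ₗ H.subtype) ∘ₗ (p + l.smulRight (-h)) := by
      ext x
      simp [hp]
      module
    rw [hfac, weight_comp_comm]
    congr 1
  rw [hsum, Finset.sum_congr rfl fun h _ => hterm h]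
  -- Here `g` maps `H` injectively into itself. Were `g|_H` the identity, sending `v₀` to itself
  -- would extend it to the identity of `U`, which is excluded.
  by_cases hm : m = 0
  · refine Finset.sum_eq_zero fun h _ => ?_
    have hlg : ∀ x : H, l (g x) = 0 := fun x => LinearMap.congr_fun hm x
    rw [hm]
    have hval : ∀ x : H, ((p ∘ₗ g ∘ₗ H.subtype + (0 : H →ₗ[F] F).smulRight (-h) : End F H) x : U)
        = g x := by
      intro x
      simp [hp, hlg]
    refine weight_eq_zero_of_injective k ?_ fun h1 => hone ?_
    · rw [← LinearMap.ker_eq_bot, LinearMap.ker_eq_bot']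
      intro x hx
      refine Subtype.ext (hinj x ?_ x.2)
      rw [← hval x, hx]
      rfl
    · refine ⟨v₀ - g v₀, LinearMap.ext fun x => ?_⟩
      have hx : x - l x • v₀ ∈ H := by simp [hH, hv₀]
      have h2 := hval ⟨_, hx⟩
      rw [h1] at h2
      simp at h2
      simp only [LinearMap.add_apply, LinearMap.smulRight_apply, Module.End.one_apply, smul_sub]
      rw [← sub_eq_zero] at h2 ⊢
      rw [← neg_eq_zero, ← h2]
      abel
  · have hlt : finrank F H < finrank F U := by
      have : finrank F H + 1 = finrank F U := Module.Dual.finrank_ker_add_one_of_ne_zero hl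
      omega
    have key := ih _ hlt (p ∘ₗ g ∘ₗ H.subtype) m hm rfl
    rw [← Equiv.sum_comp (Equiv.neg H)] at key
    exact key

/-! ### Identities for `q`-binomial coefficients. -/

section QBinomial

theorem qFactorial_pos (q n : ℕ) : 0 < qFactorial q n := by
  induction n with
  | zero => simp [qFactorial]
  | succ n ih =>
    refine Nat.mul_pos ?_ ih
    rw [qInt, Finset.sum_range_succ']
    simp

theorem qInt_mul_pred (q n : ℕ) : qInt q n * (q - 1) = q ^ n - 1 := by
  rcases q.eq_zero_or_pos with rfl | hq
  · rcases n with _ | n <;> simp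
  · obtain ⟨p, rfl⟩ := Nat.exists_eq_add_of_le' hq
    change (∑ i ∈ Finset.range n, (p + 1) ^ i) * (p + 1 - 1) = (p + 1) ^ n - 1
    rw [Nat.add_sub_cancel, ← geom_sum_mul_add, Nat.add_sub_cancel]

theorem qInt_add (q a b : ℕ) : qInt q (a + b) = qInt q a + q ^ a * qInt q b := by
  simp only [qInt, Finset.sum_range_add _ a b, Finset.mul_sum, pow_add]

theorem qBinom_zero_right (q n : ℕ) : qBinom q n 0 = 1 := by
  simp [qBinom, qFactorial, Nat.div_self (qFactorial_pos q n)]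

theorem qBinom_add_mul (q a b : ℕ) :
    qBinom q (a + b) b * (qFactorial q b * qFactorial q a) = qFactorial q (a + b) := by
  have := qBinom_mul q (Nat.le_add_left b a)
  rwa [Nat.add_sub_cancel] at this

/-- The Pascal identity for the `q`-binomial coefficients. -/
theorem qBinom_pascal (q a b : ℕ) :
    qBinom q (a + 1 + (b + 1)) (b + 1)
      = qBinom q (a + (b + 1)) (b + 1) + q ^ (a + 1) * qBinom q (a + 1 + b) b := by
  refine Nat.eq_of_mul_eq_mul_right
    (Nat.mul_pos (qFactorial_pos q (b + 1)) (qFactorial_pos q (a + 1))) ?_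
  rw [qBinom_add_mul, add_mul]
  have h1 := qBinom_add_mul q a (b + 1)
  have h2 := qBinom_add_mul q (a + 1) b
  have h3 : qFactorial q (a + 1 + (b + 1))
      = qInt q (a + 1 + (b + 1)) * qFactorial q (a + 1 + b) := rfl
  have h4 : qFactorial q (b + 1) = qInt q (b + 1) * qFactorial q b := rfl
  have h5 : qFactorial q (a + 1) = qInt q (a + 1) * qFactorial q a := rfl
  rw [show a + (b + 1) = a + 1 + b by ring] at *
  rw [h3, qInt_add, add_mul]
  nth_rw 1 [← h1]
  rw [← h2, h4, h5]
  ring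

theorem prod_pow_sub_pow (q a b : ℕ) :
    (∏ i ∈ Finset.range b, (q ^ (a + b) - q ^ i)) * qFactorial q a
      = q ^ b.choose 2 * (q - 1) ^ b * qFactorial q (a + b) := by
  induction b generalizing a with
  | zero => simp
  | succ b ih =>
    have h1 : q ^ (a + (b + 1)) - q ^ b = q ^ b * (qInt q (a + 1) * (q - 1)) := by
      rw [qInt_mul_pred, Nat.mul_sub, mul_one, ← pow_add]
      ring_nf
    have h2 := ih (a + 1)
    have h3 : qFactorial q (a + 1) = qInt q (a + 1) * qFactorial q a := rfl
    rw [Finset.prod_range_succ, h1, Nat.choose_succ_succ' b 1, Nat.choose_one_right]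
    rw [show a + 1 + b = a + (b + 1) by ring, h3] at h2
    linear_combination (q ^ b * (q - 1)) * h2

end QBinomial

/-! ### Counting subspaces over a finite field. -/

/-- The number of `b`-dimensional subspaces. -/
theorem card_submodule_finrank_eq {F V : Type*} [Field F] [Fintype F] [AddCommGroup V] [Module F V]
    [Finite V] (b : ℕ) (hb : b ≤ finrank F V) :
    Nat.card {U : Submodule F V // finrank F U = b} = qBinom (Fintype.card F) (finrank F V) b := by
  classical
  obtain ⟨a, ha⟩ := Nat.exists_eq_add_of_le' hb
  -- Double counting: independent `b`-tuples are grouped by their span, and each fibre is the set of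
  -- ordered bases of a `b`-dimensional space.
  let sp : {s : Fin b → V // LinearIndependent F s} → {U : Submodule F V // finrank F U = b} :=
    fun s => ⟨Submodule.span F (Set.range s.1), by rw [finrank_span_eq_card s.2, Fintype.card_fin]⟩
  have hfib (U : {U : Submodule F V // finrank F U = b}) :
      Nat.card {s // sp s = U}
        = ∏ i ∈ Finset.range b, (Fintype.card F ^ b - Fintype.card F ^ i) := by
    have h1 := card_linearIndependent (K := F) (V := U.1) (k := b) U.2.ge
    rw [U.2] at h1
    rw [← Fin.prod_univ_eq_prod_range (fun i => Fintype.card F ^ b - Fintype.card F ^ i), ← h1]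
    refine Nat.card_congr
      { toFun s := ⟨fun i => ⟨s.1.1 i, ?_⟩, ?_⟩
        invFun t := ⟨⟨fun i => t.1 i, ?_⟩, ?_⟩
        left_inv s := rfl
        right_inv t := rfl }
    · have := congrArg Subtype.val s.2
      rw [← this]
      exact Submodule.subset_span ⟨i, rfl⟩
    · exact LinearIndependent.of_comp U.1.subtype s.1.2
    · exact t.2.map' U.1.subtype U.1.ker_subtype
    · refine Subtype.ext (Submodule.eq_of_le_of_finrank_eq ?_ ?_)
      · rw [Submodule.span_le]
        rintro _ ⟨i, rfl⟩
        exact (t.1 i).2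
      · rw [(sp _).2, U.2]
  have hcount := card_linearIndependent (K := F) hb
  have := Fintype.ofFinite {U : Submodule F V // finrank F U = b}
  rw [← Nat.card_congr (Equiv.sigmaFiberEquiv sp), Nat.card_sigma,
    Finset.sum_congr rfl fun U _ => hfib U, Finset.sum_const, Finset.card_univ, smul_eq_mul,
    ← Nat.card_eq_fintype_card,
    Fin.prod_univ_eq_prod_range (fun i => Fintype.card F ^ finrank F V - Fintype.card F ^ i),
    ha] at hcount
  have h0 := prod_pow_sub_pow (Fintype.card F) 0 b
  have h1 := prod_pow_sub_pow (Fintype.card F) a b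
  have h2 := qBinom_add_mul (Fintype.card F) a b
  have hF : 1 < Fintype.card F := Fintype.one_lt_card
  have hpos : 0 < Fintype.card F ^ b.choose 2 * (Fintype.card F - 1) ^ b * qFactorial (Fintype.card F) b
      * qFactorial (Fintype.card F) a :=
    Nat.mul_pos (Nat.mul_pos (Nat.mul_pos (by positivity) (Nat.pow_pos (by omega)))
      (qFactorial_pos _ _)) (qFactorial_pos _ _)
  refine Nat.eq_of_mul_eq_mul_right hpos ?_
  rw [← hcount] at h1
  simp only [qFactorial, mul_one, zero_add] at h0
  rw [h0] at h1
  rw [ha]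
  linear_combination h1 + (Fintype.card F ^ b.choose 2 * (Fintype.card F - 1) ^ b) * h2.symm

theorem card_submodule_ge_finrank_eq {F V : Type*} [Field F] [Fintype F] [AddCommGroup V]
    [Module F V] [Finite V] (R : Submodule F V) (r : ℕ) (hr : r ≤ finrank F V)
    (hR : finrank F R ≤ r) :
    Nat.card {U : Submodule F V // R ≤ U ∧ finrank F U = r}
      = qBinom (Fintype.card F) (finrank F V - finrank F R) (r - finrank F R) := by
  have h1 := R.finrank_quotient_add_finrank
  have : Finite (V ⧸ R) := Module.finite_of_finite F
  rw [show finrank F V - finrank F R = finrank F (V ⧸ R) by omega,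
    ← card_submodule_finrank_eq _ (by omega)]
  symm
  refine Nat.card_congr ?_
  have hdim (U : Submodule F (V ⧸ R)) :
      finrank F (U.comap R.mkQ) = finrank F U + finrank F R := by
    have h2 := (U.comap R.mkQ).finrank_quotient_add_finrank
    have h3 := U.finrank_quotient_add_finrank
    have h4 := ((U.mkQ ∘ₗ R.mkQ).quotKerEquivOfSurjective
      (U.mkQ_surjective.comp R.mkQ_surjective)).finrank_eq
    rw [LinearMap.ker_comp, Submodule.ker_mkQ] at h4
    omega
  refine (Equiv.subtypeEquiv (q := fun U : Set.Ici R => finrank F U.1 = r)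
    (R.comapMkQRelIso).toEquiv ?_).trans
    (Equiv.subtypeSubtypeEquivSubtypeInter (fun U => R ≤ U) (fun U => finrank F U = r))
  intro U
  have := hdim U
  change _ ↔ finrank F (U.comap R.mkQ) = r
  omega

/-! ### Weighted sums over operators with image in a fixed subspace. -/

section OperatorSums

variable (k : Type*) [Field k] {F V : Type*} [Field F] [Fintype F] [AddCommGroup V] [Module F V]
  [Finite V]

theorem weight_eq_weight_restrict {W : Submodule F V} {T : End F V} (hT : ∀ x, T x ∈ W) :
    weight k T = weight k (T.codRestrict W hT ∘ₗ W.subtype : End F W) :=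
  weight_comp_comm k (T.codRestrict W hT) W.subtype

theorem weight_of_eq_id_on {W : Submodule F V} {T : End F V} (hT : ∀ x, T x ∈ W)
    (hid : ∀ x ∈ W, T x = x) : weight k T = mu k (Fintype.card F) (finrank F W) := by
  rw [← weight_one, weight_eq_weight_restrict k hT]
  congr 1
  ext x
  simp [hid]

theorem weight_of_injOn {W : Submodule F V} {T : End F V} (hT : ∀ x, T x ∈ W)
    (hinj : ∀ x ∈ W, T x = 0 → x = 0) (hid : ¬ ∀ x ∈ W, T x = x) : weight k T = 0 := by
  rw [weight_eq_weight_restrict k hT]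
  refine weight_eq_zero_of_injective k ?_ fun h => hid fun x hx => ?_
  · rw [← LinearMap.ker_eq_bot, LinearMap.ker_eq_bot']
    intro x hx
    exact Subtype.ext (hinj x x.2 (congrArg Subtype.val hx))
  · exact congrArg Subtype.val (LinearMap.congr_fun h ⟨x, hx⟩)

/-- Pick `l` zero on `W` but not on `U`. Translating `T` by `l ⊗ u` with `u ∈ U` leaves `G T`
unchanged, so averaging over `u` brings in the vanishing sum on `U`. The average is legitimate
because `|U|` is a power of `q`, nonzero in `k`. -/
theorem sum_weight_smul_eq_zero [Fintype (End F V)] (hq : (Fintype.card F : k) ≠ 0)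
    {M : Type*} [AddCommGroup M] [Module k M] {U W : Submodule F V} (hUW : ¬ U ≤ W)
    [DecidablePred fun T : End F V => ∀ x, T x ∈ U] (G : End F V → M) (hG : ∀ S T : End F V, (∀ x ∈ W, S x = T x) → G S = G T) :
    ∑ T : End F V with ∀ x, T x ∈ U, weight k T • G T = 0 := by
  obtain ⟨v, hvU, hvW⟩ := SetLike.not_le_iff_exists.1 hUW
  obtain ⟨l, hlv, hlW⟩ := Submodule.exists_dual_map_eq_bot_of_notMem hvW inferInstance
  have hlW' (x) (hx : x ∈ W) : l x = 0 := by
    have := Submodule.mem_map_of_mem (f := l) hx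
    rwa [hlW] at this
  have hl : l ∘ₗ U.subtype ≠ 0 := fun h => hlv (LinearMap.congr_fun h ⟨v, hvU⟩)
  have := Fintype.ofFinite U
  set S := ∑ T : End F V with ∀ x, T x ∈ U, weight k T • G T with hS
  have htrans (u : U) : S = ∑ T : End F V with ∀ x, T x ∈ U,
      weight k (T + l.smulRight (u : V) : End F V) • G T := by
    rw [hS]
    symm
    refine Finset.sum_equiv (Equiv.addRight (l.smulRight (u : V) : End F V)) ?_ ?_
    · intro T
      simp only [Finset.mem_filter, Finset.mem_univ, true_and, Equiv.coe_addRight,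
        LinearMap.add_apply, LinearMap.smulRight_apply]
      exact forall_congr' fun x => (U.add_mem_iff_left (U.smul_mem _ u.2)).symm
    · intro T _
      rw [hG T (T + l.smulRight (u : V)) fun x hx => by simp [hlW' x hx]]
      rfl
  have hcard : (Fintype.card U : k) • S = 0 := by
    calc (Fintype.card U : k) • S = ∑ u : U, S := by
          rw [Finset.sum_const, Finset.card_univ, Nat.cast_smul_eq_nsmul]
      _ = ∑ T : End F V with ∀ x, T x ∈ U,
            (∑ u : U, weight k (T + l.smulRight (u : V) : End F V)) • G T := by
          rw [Finset.sum_congr rfl fun u _ => htrans u, Finset.sum_comm]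
          exact Finset.sum_congr rfl fun T _ => (Finset.sum_smul).symm
      _ = 0 := by
          refine Finset.sum_eq_zero fun T hT => ?_
          have hTU := (Finset.mem_filter.1 hT).2
          have hu (u : U) (x : V) : (T + l.smulRight (u : V) : End F V) x ∈ U :=
            U.add_mem (hTU x) (U.smul_mem _ u.2)
          rw [Finset.sum_congr rfl fun u _ => weight_eq_weight_restrict k (hu u)]
          exact (congrArg (· • G T) (sum_weight_add_smulRight k
            (T.codRestrict U hTU ∘ₗ U.subtype) _ hl)).trans (zero_smul _ _)
  rw [Module.card_eq_pow_finrank (K := F), Nat.cast_pow] at hcard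
  exact (smul_eq_zero.1 hcard).resolve_left (pow_ne_zero _ hq)

/-- Projections onto `W` form a torsor under `Hom(V/W, W)`; the retraction `p` serves as base point.
-/
theorem card_projections [Fintype (End F V)] (W : Submodule F V)
    [DecidablePred fun T : End F V => (∀ x, T x ∈ W) ∧ ∀ x ∈ W, T x = x] :
    (Finset.univ.filter fun T : End F V => (∀ x, T x ∈ W) ∧ ∀ x ∈ W, T x = x).card
      = Fintype.card F ^ (finrank F W * (finrank F V - finrank F W)) := by
  obtain ⟨p, hp⟩ := LinearMap.exists_leftInverse_of_injective W.subtype W.ker_subtype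
  have hp' (x : V) (hx : x ∈ W) : p x = ⟨x, hx⟩ := LinearMap.congr_fun hp ⟨x, hx⟩
  have h1 := W.finrank_quotient_add_finrank
  rw [← Fintype.card_subtype, ← Nat.card_eq_fintype_card,
    show finrank F W * (finrank F V - finrank F W) = finrank F (V ⧸ W →ₗ[F] W) by
      rw [finrank_linearMap, mul_comm]; congr 1; omega]
  have : Finite (V ⧸ W →ₗ[F] W) := Module.finite_of_finite F
  have := Fintype.ofFinite (V ⧸ W →ₗ[F] W)
  rw [← Module.card_eq_pow_finrank, ← Nat.card_eq_fintype_card]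
  refine Nat.card_congr
    { toFun T := W.liftQ (T.1.codRestrict W T.2.1 - p) ?_
      invFun D := ⟨W.subtype ∘ₗ (p + D ∘ₗ W.mkQ), ?_, ?_⟩
      left_inv T := ?_
      right_inv D := ?_ }
  · intro x hx
    refine Subtype.ext ?_
    simp [hp' x hx, T.2.2 x hx]
  · exact fun x => (p x + D (W.mkQ x)).2
  · intro x hx
    simp [hp' x hx, (Submodule.Quotient.mk_eq_zero W).2 hx]
  · refine Subtype.ext (LinearMap.ext fun x => ?_)
    change ((p x + (T.1.codRestrict W T.2.1 x - p x) : W) : V) = T.1 x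
    simp
  · ext x
    change ((p x + D (W.mkQ x) - p x : W) : V) = D (W.mkQ x)
    simp

end OperatorSums

/-! ### Translation to matrices, and invariance under transposition. -/

section Matrices

variable (k : Type*) [Field k] {F : Type*} [Field F] {n : ℕ}

theorem isSemiIdempotent_iff {V : Type*} [AddCommGroup V] [Module F V] (T : End F V) :
    IsSemiIdempotent T ↔ ∃ N : ℕ, T ^ (N + 1) = T ^ N := by
  constructor
  · rintro ⟨X, Y, hXY, hX, -, N, hN⟩
    refine ⟨N, LinearMap.ext fun v => ?_⟩
    obtain ⟨x, hx, y, hy, rfl⟩ := Submodule.mem_sup.1 (hXY.sup_eq_top.symm ▸ Submodule.mem_top : v ∈ X ⊔ Y)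
    rw [map_add, map_add, pow_succ, Module.End.mul_apply, hX x hx, ← pow_succ, pow_succ',
      Module.End.mul_apply, hN y hy, map_zero]
  · rintro ⟨N, hN⟩
    have hst (i : ℕ) : T ^ (N + i) = T ^ N := by
      induction i with
      | zero => rfl
      | succ i ih => rw [← add_assoc, pow_succ, ih, ← pow_succ, hN]
    have hid : IsIdempotentElem (T ^ N) := by
      rw [IsIdempotentElem, ← pow_add, hst]
    refine ⟨_, _, (LinearMap.IsIdempotentElem.isCompl hid), ?_, ?_, N, fun y hy => hy⟩
    · rintro _ ⟨x, rfl⟩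
      rw [← Module.End.mul_apply, ← pow_succ', hN]
    · intro y hy
      rw [LinearMap.mem_ker] at hy ⊢
      rw [← Module.End.mul_apply, ← pow_succ, pow_succ', Module.End.mul_apply, hy, map_zero]

theorem toLin'_pow (m : Matrix (Fin n) (Fin n) F) (i : ℕ) :
    Matrix.toLin' (m ^ i) = (Matrix.toLin' m) ^ i :=
  map_pow (Matrix.toLinAlgEquiv' (R := F) (n := Fin n)) m i

theorem rank_eq_finrank_range (m : Matrix (Fin n) (Fin n) F) :
    m.rank = finrank F (LinearMap.range (Matrix.toLin' m)) := by
  rw [Matrix.toLin'_apply']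
  rfl

theorem stableRank_eq (m : Matrix (Fin n) (Fin n) F) :
    stableRank m = endStableRank (Matrix.toLin' m) := by
  rw [stableRank, endStableRank]
  refine iInf_congr fun i => ?_
  rw [rank_eq_finrank_range, toLin'_pow]

open Classical in
theorem weight_toLin' [Fintype F] (m : Matrix (Fin n) (Fin n) F) :
    weight k (Matrix.toLin' m)
      = if IsSemiIdempotent (Matrix.toLin' m) then mu k (Fintype.card F) (stableRank m) else 0 := by
  rw [weight, stableRank_eq]
  by_cases h : IsSemiIdempotent (Matrix.toLin' m)
  · rw [if_pos h, if_pos ((isSemiIdempotent_iff _).1 h)]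
  · rw [if_neg h, if_neg fun h' => h ((isSemiIdempotent_iff _).2 h')]

theorem weight_transpose [Fintype F] (m : Matrix (Fin n) (Fin n) F) :
    weight k (Matrix.toLin' m.transpose) = weight k (Matrix.toLin' m) := by
  have h1 : stableRank m.transpose = stableRank m := by
    refine iInf_congr fun i => ?_
    rw [← Matrix.transpose_pow, Matrix.rank_transpose]
  have h2 : IsSemiIdempotent (Matrix.toLin' m.transpose) ↔ IsSemiIdempotent (Matrix.toLin' m) := by
    rw [isSemiIdempotent_iff, isSemiIdempotent_iff]
    refine exists_congr fun N => ?_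
    rw [← toLin'_pow, ← toLin'_pow, ← toLin'_pow, ← toLin'_pow, Matrix.toLin'.injective.eq_iff,
      Matrix.toLin'.injective.eq_iff, ← Matrix.transpose_pow, ← Matrix.transpose_pow,
      Matrix.transpose_inj]
  rw [weight_toLin', weight_toLin', h1]
  by_cases h : IsSemiIdempotent (Matrix.toLin' m)
  · rw [if_pos h, if_pos (h2.2 h)]
  · rw [if_neg h, if_neg (h2.not.2 h)]

/-! ### The rank filtration of the monoid algebra. -/

/-- The subspace of `k[M_n]` spanned by the `[m]` with `rank m < r`. -/
noncomputable def rankSpanLT (F : Type*) [Field F] (n r : ℕ) :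
    Submodule k (MonoidAlgebra k (Matrix (Fin n) (Fin n) F)) :=
  Submodule.span k {x | ∃ m : Matrix (Fin n) (Fin n) F, m.rank < r ∧ x = MonoidAlgebra.single m 1}

theorem rankSpanLT_succ (r : ℕ) : rankSpanLT k F n (r + 1) = rankSpan k F n r := by
  simp only [rankSpanLT, rankSpan, Nat.lt_succ_iff]

theorem rankSpanLT_zero : rankSpanLT k F n 0 = ⊥ := by
  simp [rankSpanLT]

theorem single_mem_rankSpanLT {r : ℕ} {m : Matrix (Fin n) (Fin n) F} (hm : m.rank < r) :
    MonoidAlgebra.single m (1 : k) ∈ rankSpanLT k F n r :=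
  Submodule.subset_span ⟨m, hm, rfl⟩

/-- The linear map `[m] ↦ [mᵀ]` of `k[M_n]`. -/
noncomputable def transposeMap (F : Type*) [Field F] (n : ℕ) :
    MonoidAlgebra k (Matrix (Fin n) (Fin n) F) →ₗ[k]
      MonoidAlgebra k (Matrix (Fin n) (Fin n) F) where
  toFun := MonoidAlgebra.mapDomain Matrix.transpose
  map_add' := MonoidAlgebra.mapDomain_add _
  map_smul' c x := by ext; simp

theorem transposeMap_single (m : Matrix (Fin n) (Fin n) F) (c : k) :
    transposeMap k F n (MonoidAlgebra.single m c) = MonoidAlgebra.single m.transpose c :=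
  MonoidAlgebra.mapDomain_single

theorem transposeMap_mem {r : ℕ} {x : MonoidAlgebra k (Matrix (Fin n) (Fin n) F)}
    (hx : x ∈ rankSpanLT k F n r) : transposeMap k F n x ∈ rankSpanLT k F n r := by
  have : rankSpanLT k F n r ≤ (rankSpanLT k F n r).comap (transposeMap k F n) := by
    refine Submodule.span_le.2 ?_
    rintro _ ⟨m, hm, rfl⟩
    change transposeMap k F n (MonoidAlgebra.single m 1) ∈ rankSpanLT k F n r
    rw [transposeMap_single]
    exact single_mem_rankSpanLT k (by rwa [Matrix.rank_transpose])
  exact this hx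

/-- The exponents match: `μ(r)^2 = q^(r(r-1))` and `r(n-r) + r(r-1) = (n-1)r`. -/
theorem normalization_mul {q : ℕ} (hq : (q : k) ≠ 0) {n r : ℕ} (hr : r < n) :
    (((q : k) ^ ((n - 1) * r))⁻¹ * mu k (q) r)
      * ((q : k) ^ (r * (n - r)) * mu k (q) r) = 1 := by
  have h1 : r.choose 2 * 2 = r * (r - 1) := by
    rw [Nat.choose_two_right, Nat.div_mul_cancel (Nat.even_mul_pred_self r).two_dvd]
  have h2 : r * (n - r) + r.choose 2 * 2 = (n - 1) * r := by
    rw [h1, ← mul_add, mul_comm]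
    rcases r with _ | r
    · simp
    · congr 1; omega
  have h3 : mu k (q) r * mu k (q) r
      = (q : k) ^ (r.choose 2 * 2) := by
    rw [mu, mul_mul_mul_comm, ← mul_pow, pow_mul]
    simp [sq]
  rw [mul_mul_mul_comm, h3, mul_assoc, ← pow_add, h2]
  exact inv_mul_cancel₀ (pow_ne_zero _ hq)

/-! ### The Grassmannian sum and its products with matrices. -/

variable (F n) [Fintype F]

open Classical in
/-- The semi-idempotent `m` of rank at most `r`, weighted by `μ` of the stable rank and the number
of `r`-dimensional subspaces that contain the image of `m`. -/
noncomputable def grassmannSum (r : ℕ) : MonoidAlgebra k (Matrix (Fin n) (Fin n) F) :=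
  ∑ m : Matrix (Fin n) (Fin n) F, (weight k (Matrix.toLin' m) *
    (Nat.card {U : Submodule F (Fin n → F) //
      LinearMap.range (Matrix.toLin' m) ≤ U ∧ finrank F U = r} : k)) • MonoidAlgebra.single m (1 : k)

variable {F n}

open Classical in
theorem grassmannSum_mul_single [Fintype (End F (Fin n → F))]
    [Fintype (Submodule F (Fin n → F))] (r : ℕ) (x : Matrix (Fin n) (Fin n) F) :
    grassmannSum k F n r * MonoidAlgebra.single x 1
      = ∑ U ∈ Finset.univ.filter fun U : Submodule F (Fin n → F) => finrank F U = r,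
          ∑ T : End F (Fin n → F) with ∀ v, T v ∈ U,
            weight k T • MonoidAlgebra.single (LinearMap.toMatrix' T * x) (1 : k) := by
  rw [grassmannSum, Finset.sum_mul, ← LinearMap.toMatrix'.toEquiv.sum_comp]
  simp_rw [Finset.sum_filter (fun T : End F (Fin n → F) => ∀ v, T v ∈ _)]
  rw [Finset.sum_comm]
  refine Finset.sum_congr rfl fun T _ => ?_
  have hcard : Nat.card {U : Submodule F (Fin n → F) // LinearMap.range T ≤ U ∧ finrank F U = r}
      = ((Finset.univ.filter fun U : Submodule F (Fin n → F) => finrank F U = r).filter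
          fun U => ∀ v, T v ∈ U).card := by
    rw [Nat.card_eq_fintype_card, Fintype.card_subtype, Finset.filter_filter]
    congr 1
    refine Finset.filter_congr fun U _ => ?_
    rw [and_comm, ← SetLike.coe_subset_coe, LinearMap.coe_range, Set.range_subset_iff]
    rfl
  rw [← Finset.sum_filter, Finset.sum_const, smul_mul_assoc, MonoidAlgebra.single_mul_single,
    mul_one, mul_comm (weight k _), mul_smul, Nat.cast_smul_eq_nsmul, ← hcard]
  simp only [LinearEquiv.coe_toEquiv, Matrix.toLin'_toMatrix']

theorem grassmannSum_mul_single_of_rank (hq : (Fintype.card F : k) ≠ 0) {r : ℕ}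
    (x : Matrix (Fin n) (Fin n) F) :
    (x.rank < r → grassmannSum k F n r * MonoidAlgebra.single x 1 = 0) ∧
    (x.rank = r → grassmannSum k F n r * MonoidAlgebra.single x 1
      - ((Fintype.card F : k) ^ (r * (n - r)) * mu k (Fintype.card F) r) •
        MonoidAlgebra.single x (1 : k) ∈ rankSpanLT k F n r) := by
  classical
  have := Fintype.ofFinite (Submodule F (Fin n → F))
  have : Finite (End F (Fin n → F)) := Module.finite_of_finite F
  have := Fintype.ofFinite (End F (Fin n → F))
  set W := LinearMap.range (Matrix.toLin' x) with hW
  let G : End F (Fin n → F) → MonoidAlgebra k (Matrix (Fin n) (Fin n) F) :=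
    fun T => MonoidAlgebra.single (LinearMap.toMatrix' T * x) 1
  have hexp := grassmannSum_mul_single k r x
  have hG : ∀ S T : End F (Fin n → F), (∀ v ∈ W, S v = T v) → G S = G T := by
    intro S T h
    simp only [G]
    congr 1
    refine Matrix.toLin'.injective ?_
    rw [Matrix.toLin'_mul, Matrix.toLin'_mul, Matrix.toLin'_toMatrix', Matrix.toLin'_toMatrix']
    exact LinearMap.ext fun v => h _ ⟨v, rfl⟩
  have hWr : finrank F W = x.rank := (rank_eq_finrank_range x).symm
  constructor
  · intro hlt
    rw [hexp]
    refine Finset.sum_eq_zero fun U hU => sum_weight_smul_eq_zero k hq (fun hUW => ?_) G hG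
    have := Submodule.finrank_mono hUW
    rw [(Finset.mem_filter.1 hU).2, hWr] at this
    omega
  · intro heq
    rw [hexp, Finset.sum_eq_single_of_mem W (by simp [hWr, heq])]
    swap
    · intro U hU hne
      refine sum_weight_smul_eq_zero k hq (fun hUW => hne ?_) G hG
      refine Submodule.eq_of_le_of_finrank_eq hUW ?_
      rw [(Finset.mem_filter.1 hU).2, hWr, heq]
    have hn : finrank F (Fin n → F) = n := by simp
    have hmain : ∑ T : End F (Fin n → F) with (∀ v, T v ∈ W) ∧ ∀ v ∈ W, T v = v, weight k T • G T
        = ((Fintype.card F : k) ^ (r * (n - r)) * mu k (Fintype.card F) r) •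
          MonoidAlgebra.single x (1 : k) := by
      have hterm : ∀ T ∈ Finset.univ.filter fun T : End F (Fin n → F) =>
          (∀ v, T v ∈ W) ∧ ∀ v ∈ W, T v = v,
          weight k T • G T = mu k (Fintype.card F) r • MonoidAlgebra.single x (1 : k) := by
        intro T hT
        obtain ⟨h1, h2⟩ := (Finset.mem_filter.1 hT).2
        rw [weight_of_eq_id_on k h1 h2, hWr, heq, hG T 1 h2]
        simp [G]
      rw [Finset.sum_congr rfl hterm, Finset.sum_const, card_projections, hWr, heq, hn,
        ← Nat.cast_smul_eq_nsmul k, smul_smul, Nat.cast_pow]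
    rw [← hmain, ← Finset.sum_filter_add_sum_filter_not _ (fun T => ∀ v ∈ W, T v = v),
      Finset.filter_filter, add_sub_cancel_left]
    refine Submodule.sum_mem _ fun T hT => ?_
    simp only [Finset.mem_filter, Finset.mem_univ, true_and] at hT
    -- A non-identity `T` on `W` either is injective there, hence of weight zero, or shrinks `W`, so
    -- that `Tx` has smaller rank.
    by_cases hinj : ∀ v ∈ W, T v = 0 → v = 0
    · rw [weight_of_injOn k hT.1 hinj hT.2, zero_smul]
      exact Submodule.zero_mem _
    · refine Submodule.smul_mem _ _ (single_mem_rankSpanLT k ?_)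
      push Not at hinj
      obtain ⟨w, hwW, hw, hw0⟩ := hinj
      rw [rank_eq_finrank_range, Matrix.toLin'_mul, Matrix.toLin'_toMatrix', LinearMap.range_comp,
        ← hW]
      have h1 := (T.domRestrict W).finrank_range_add_finrank_ker
      rw [LinearMap.range_domRestrict, hWr, heq] at h1
      have h2 : 0 < finrank F (LinearMap.ker (T.domRestrict W)) := by
        rw [Nat.pos_iff_ne_zero, Ne, Submodule.finrank_eq_zero, ← Ne, Submodule.ne_bot_iff]
        exact ⟨⟨w, hwW⟩, hw, fun h => hw0 (congrArg Subtype.val h)⟩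
      omega

theorem card_submodule_ge_range {r : ℕ} (hr : r ≤ n) (m : Matrix (Fin n) (Fin n) F) :
    Nat.card {U : Submodule F (Fin n → F) //
        LinearMap.range (Matrix.toLin' m) ≤ U ∧ finrank F U = r}
      = if m.rank ≤ r then qBinom (Fintype.card F) (n - m.rank) (r - m.rank) else 0 := by
  have hn : finrank F (Fin n → F) = n := by simp
  split_ifs with hm
  · rw [rank_eq_finrank_range] at hm ⊢
    rw [card_submodule_ge_finrank_eq _ r (by rwa [hn]) hm, hn]
  · have : IsEmpty {U : Submodule F (Fin n → F) //
        LinearMap.range (Matrix.toLin' m) ≤ U ∧ finrank F U = r} := by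
      refine ⟨fun U => hm ?_⟩
      have := Submodule.finrank_mono U.2.1
      rwa [U.2.2, ← rank_eq_finrank_range] at this
    exact Nat.card_of_isEmpty

/-- Transposition reverses products and fixes the Grassmannian sum, whose coefficients depend only
on the rank and the weight. -/
theorem single_mul_grassmannSum {r : ℕ} (hr : r ≤ n) (x : Matrix (Fin n) (Fin n) F) :
    MonoidAlgebra.single x 1 * grassmannSum k F n r
      = transposeMap k F n (grassmannSum k F n r * MonoidAlgebra.single x.transpose 1) := by
  classical
  rw [grassmannSum, Finset.mul_sum, Finset.sum_mul, map_sum,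
    ← (Matrix.transposeAddEquiv (Fin n) (Fin n) F).toEquiv.sum_comp]
  refine Finset.sum_congr rfl fun m _ => ?_
  change MonoidAlgebra.single x 1 * (_ * ((Nat.card {U : Submodule F (Fin n → F) //
    LinearMap.range (Matrix.toLin' m.transpose) ≤ U ∧ finrank F U = r} : ℕ) : k)) •
      MonoidAlgebra.single m.transpose (1 : k) = _
  rw [card_submodule_ge_range hr, card_submodule_ge_range hr, Matrix.rank_transpose,
    smul_mul_assoc, mul_smul_comm, map_smul, MonoidAlgebra.single_mul_single,
    MonoidAlgebra.single_mul_single, transposeMap_single, Matrix.transpose_mul,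
    Matrix.transpose_transpose]
  congr 2
  exact weight_transpose k m

theorem grassmannSum_mem {r : ℕ} (hr : r ≤ n) :
    grassmannSum k F n r ∈ rankSpanLT k F n (r + 1) := by
  classical
  refine Submodule.sum_mem _ fun m _ => ?_
  rw [card_submodule_ge_range hr]
  split_ifs with hm
  · exact Submodule.smul_mem _ _ (single_mem_rankSpanLT k (by omega))
  · simp

/-! ### The recursion for `η_r`. -/

theorem eta_eq_sum (r : ℕ) :
    eta k F n r = (((Fintype.card F : k) ^ ((n - 1) * r))⁻¹ * mu k (Fintype.card F) r) •
      ∑ m : Matrix (Fin n) (Fin n) F, (weight k (Matrix.toLin' m) *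
        ((if m.rank ≤ r then qBinom (Fintype.card F) (n - 1 - m.rank) (r - m.rank) else 0 : ℕ) : k))
          • MonoidAlgebra.single m (1 : k) := by
  classical
  rw [eta, Finset.sum_filter]
  congr 1
  refine Finset.sum_congr rfl fun m _ => ?_
  rw [weight_toLin']
  by_cases h1 : IsSemiIdempotent (Matrix.toLin' m)
  · by_cases h2 : m.rank ≤ r
    · rw [if_pos ⟨h1, h2⟩, if_pos h1, if_pos h2]
    · rw [if_neg fun h => h2 h.2, if_neg h2, Nat.cast_zero, mul_zero, zero_smul]
  · rw [if_neg fun h => h1 h.1, if_neg h1, zero_mul, zero_smul]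

theorem eta_zero : eta k F n 0 = grassmannSum k F n 0 := by
  classical
  rw [eta_eq_sum, grassmannSum]
  simp only [mul_zero, pow_zero, inv_one, mu, Nat.choose_zero_succ, mul_one, one_smul]
  refine Finset.sum_congr rfl fun m _ => ?_
  rw [card_submodule_ge_range (Nat.zero_le n)]
  split_ifs with hm
  · rw [Nat.zero_sub, qBinom_zero_right, qBinom_zero_right]
  · rfl

theorem eta_succ (hq : (Fintype.card F : k) ≠ 0) {r : ℕ} (hr : r + 1 < n) :
    eta k F n (r + 1) = eta k F n r
      + (((Fintype.card F : k) ^ ((n - 1) * (r + 1)))⁻¹ * mu k (Fintype.card F) (r + 1)) •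
        grassmannSum k F n (r + 1) := by
  classical
  rw [eta_eq_sum, eta_eq_sum, grassmannSum, Finset.smul_sum, Finset.smul_sum, Finset.smul_sum,
    ← Finset.sum_add_distrib]
  refine Finset.sum_congr rfl fun m _ => ?_
  rw [card_submodule_ge_range hr.le, smul_smul, smul_smul, smul_smul, ← add_smul]
  congr 1
  obtain ⟨a, rfl⟩ : ∃ a, n = a + r + 2 := ⟨n - r - 2, by omega⟩
  -- With `a + 1 = n - 1 - r`, the power `q^(a+1)` is the one in the Pascal identity, so the term
  -- `η_r` cancels its second summand.
  have hc : ((Fintype.card F : k) ^ ((a + r + 2 - 1) * r))⁻¹ * mu k (Fintype.card F) r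
      + ((Fintype.card F : k) ^ ((a + r + 2 - 1) * (r + 1)))⁻¹ * mu k (Fintype.card F) (r + 1)
        * (Fintype.card F : k) ^ (a + 1) = 0 := by
    rw [mu_succ, show a + r + 2 - 1 = a + 1 + r by omega, mul_add_one, pow_add _ _ (a + 1 + r),
      pow_add _ (a + 1) r]
    field_simp
    ring
  generalize ((Fintype.card F : k) ^ ((a + r + 2 - 1) * r))⁻¹ * mu k (Fintype.card F) r = c at hc ⊢
  generalize ((Fintype.card F : k) ^ ((a + r + 2 - 1) * (r + 1)))⁻¹
    * mu k (Fintype.card F) (r + 1) = d at hc ⊢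
  rcases Nat.lt_trichotomy m.rank (r + 1) with hm | hm | hm
  · obtain ⟨b, hb⟩ : ∃ b, r = m.rank + b := ⟨r - m.rank, by omega⟩
    rw [if_pos (by omega), if_pos (by omega), if_pos (by omega),
      show a + r + 2 - m.rank = a + 1 + (b + 1) by omega,
      show a + r + 2 - 1 - m.rank = a + 1 + b by omega,
      show r + 1 - m.rank = b + 1 by omega, show r - m.rank = b by omega,
      qBinom_pascal, show a + (b + 1) = a + 1 + b by omega]
    push_cast
    linear_combination (-weight k (Matrix.toLin' m)
      * (qBinom (Fintype.card F) (a + 1 + b) b : k)) * hc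
  · rw [if_pos hm.le, if_neg (by omega), hm, Nat.sub_self, qBinom_zero_right, if_pos le_rfl,
      qBinom_zero_right]
    simp
  · rw [if_neg (by omega), if_neg (by omega), if_neg (by omega)]
    simp

/-! ### Induction on the rank. -/

/-- An element of a subspace `L` which is a two-sided unit for `L`. -/
def IsUnitOn {A : Type*} [Semiring A] [Module k A] (e : A) (L : Submodule k A) : Prop :=
  e ∈ L ∧ ∀ x ∈ L, e * x = x ∧ x * e = x

theorem isUnitOn_add_grassmannSum (hq : (Fintype.card F : k) ≠ 0) {r : ℕ} (hr : r < n)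
    {e : MonoidAlgebra k (Matrix (Fin n) (Fin n) F)} (he : IsUnitOn k e (rankSpanLT k F n r)) :
    IsUnitOn k (e + (((Fintype.card F : k) ^ ((n - 1) * r))⁻¹ * mu k (Fintype.card F) r) •
      grassmannSum k F n r) (rankSpanLT k F n (r + 1)) := by
  obtain ⟨heL, he⟩ := he
  have hch := normalization_mul k hq hr
  set c := ((Fintype.card F : k) ^ ((n - 1) * r))⁻¹ * mu k (Fintype.card F) r
  set h := (Fintype.card F : k) ^ (r * (n - r)) * mu k (Fintype.card F) r with hh
  set t := grassmannSum k F n r with ht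
  have hleft (y) (hy : y ∈ rankSpanLT k F n r) : t * y = 0 := by
    have : rankSpanLT k F n r ≤ LinearMap.ker (LinearMap.mulLeft k t) := by
      refine Submodule.span_le.2 ?_
      rintro _ ⟨m, hm, rfl⟩
      exact (grassmannSum_mul_single_of_rank k hq m).1 hm
    exact this hy
  have hright (y) (hy : y ∈ rankSpanLT k F n r) : y * t = 0 := by
    have : rankSpanLT k F n r ≤ LinearMap.ker (LinearMap.mulRight k t) := by
      refine Submodule.span_le.2 ?_
      rintro _ ⟨m, hm, rfl⟩
      change MonoidAlgebra.single m 1 * t = 0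
      rw [single_mul_grassmannSum k hr.le, (grassmannSum_mul_single_of_rank k hq m.transpose).1
        (by rwa [Matrix.rank_transpose]), map_zero]
    exact this hy
  have hle : rankSpanLT k F n r ≤ rankSpanLT k F n (r + 1) :=
    Submodule.span_mono fun x ⟨m, hm, hx⟩ => ⟨m, by omega, hx⟩
  refine ⟨add_mem (hle heL) (Submodule.smul_mem _ _ (grassmannSum_mem k hr.le)), fun y hy => ?_⟩
  have hspan : rankSpanLT k F n (r + 1) ≤
      LinearMap.ker (LinearMap.mulLeft k (e + c • t) - LinearMap.id) ⊓
      LinearMap.ker (LinearMap.mulRight k (e + c • t) - LinearMap.id) := by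
    refine Submodule.span_le.2 ?_
    rintro _ ⟨m, hm, rfl⟩
    suffices (e + c • t) * MonoidAlgebra.single m 1 = MonoidAlgebra.single m 1 ∧
        MonoidAlgebra.single m 1 * (e + c • t) = MonoidAlgebra.single m 1 from
      ⟨sub_eq_zero.2 this.1, sub_eq_zero.2 this.2⟩
    rcases (Nat.lt_succ_iff.1 hm).lt_or_eq with hlt | heq
    · have hmem := single_mem_rankSpanLT k hlt
      rw [add_mul, mul_add, smul_mul_assoc, mul_smul_comm, hleft _ hmem, hright _ hmem,
        (he _ hmem).1, (he _ hmem).2]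
      simp
    · have hz := (grassmannSum_mul_single_of_rank k hq m).2 heq
      have hw := (grassmannSum_mul_single_of_rank k hq m.transpose).2
        ((Matrix.rank_transpose m).trans heq)
      have hw' := transposeMap_mem k hw
      rw [map_sub, ← single_mul_grassmannSum k hr.le, map_smul, transposeMap_single,
        Matrix.transpose_transpose] at hw'
      rw [← ht, ← hh] at hz hw'
      set x := MonoidAlgebra.single m (1 : k)
      -- `e` fixes `t x - h x`, which has lower rank, while `e t = 0`. Hence `t x = h (x - e x)`,
      -- and `c h = 1` gives `(e + c t) x = x`; likewise on the right.
      have h1 := (he _ hz).1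
      rw [mul_sub, ← mul_assoc, hright e heL, zero_mul, zero_sub, mul_smul_comm] at h1
      have h2 := (he _ hw').2
      rw [sub_mul, mul_assoc, hleft e heL, mul_zero, zero_sub, smul_mul_assoc] at h2
      have h3 : t * x = h • (x - e * x) := by
        rw [smul_sub, sub_eq_add_neg, h1]; abel
      have h4 : x * t = h • (x - x * e) := by
        rw [smul_sub, sub_eq_add_neg, h2]; abel
      rw [add_mul, mul_add, smul_mul_assoc, mul_smul_comm, h3, h4, smul_smul, smul_smul, hch,
        one_smul, one_smul]
      exact ⟨add_sub_cancel _ _, add_sub_cancel _ _⟩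
  exact ⟨sub_eq_zero.1 (hspan hy).1, sub_eq_zero.1 (hspan hy).2⟩

theorem isUnitOn_eta (hq : (Fintype.card F : k) ≠ 0) {r : ℕ} (hr : r < n) :
    IsUnitOn k (eta k F n r) (rankSpan k F n r) := by
  induction r with
  | zero =>
    have := isUnitOn_add_grassmannSum k hq hr (e := 0) (by
      rw [rankSpanLT_zero]
      exact ⟨zero_mem _, fun x hx => by simp [(Submodule.mem_bot k).1 hx]⟩)
    rw [rankSpanLT_succ] at this
    simpa [eta_zero, mu] using this
  | succ r ih =>
    rw [eta_succ k hq hr, ← rankSpanLT_succ]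
    exact isUnitOn_add_grassmannSum k hq hr (by rw [rankSpanLT_succ]; exact ih (by omega))

end Matrices

end MatrixMonoid

theorem theorem4p1 (k F : Type*) [Field k] [Field F] [Fintype F]
    (hq : (Fintype.card F : k) ≠ 0) (n r : ℕ) (hr : r < n) :
    MatrixMonoid.eta k F n r ∈ MatrixMonoid.rankIdeal k F n r ∧
      ∀ x ∈ MatrixMonoid.rankIdeal k F n r,
        MatrixMonoid.eta k F n r * x = x ∧ x * MatrixMonoid.eta k F n r = x := by
  simp only [MatrixMonoid.mem_rankIdeal]
  exact MatrixMonoid.isUnitOn_eta k hq hr
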